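/- Let $\mathbf{H}$ and $\mathbf{E}$ be non-zero real $L\times K$ matrices with $d=\operatorname{rank}\mathbf{H}<\min(L,K)$. Let $\|\cdot\|$ denote the spectral norm. For $\delta\in\mathbb{R}$ put $\mathbf{H}(\delta)=\mathbf{H}+\delta\mathbf{E}$, $\mathbf{A}=\mathbf{H}\mathbf{H}^{\rm T}$, $\mathbf{A}^{(1)}=\mathbf{H}\mathbf{E}^{\rm T}+\mathbf{E}\mathbf{H}^{\rm T}$, $\mathbf{A}^{(2)}=\mathbf{E}\mathbf{E}^{\rm T}$, $\mathbf{B}(\delta)=\delta\mathbf{A}^{(1)}+\delta^2\mathbf{A}^{(2)}$ (so that $\mathbf{H}(\delta)\mathbf{H}(\delta)^{\rm T}=\mathbf{A}+\mathbf{B}(\delta)$), and let $B(\delta)=|\delta|\,\|\mathbf{A}^{(1)}\|+\delta^2\|\mathbf{A}^{(2)}\|$. For an eigenvalue $\mu$ of $\mathbf{A}$ let $\mathbf{P}_\mu$ be the orthogonal projector of $\mathbb{R}^L$ onto the corresponding eigenspace; in particular $\mathbf{P}_0$ is the projector onto the kernel of $\mathbf{A}$, and $\mathbf{P}_0^\perp=\mathbf{I}-\mathbf{P}_0$.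 Let $\mathbf{P}_0^\perp(\delta)$ be the orthogonal projector onto the linear space spanned by $d$ leading left singular vectors of $\mathbf{H}(\delta)$. Let $\mu_{\min}$ be the minimal positive eigenvalue of $\mathbf{A}$, and let $\mathbf{S}_0$ be the pseudoinverse of $\mathbf{A}$. Assume that $\delta_0>0$, $B(\delta_0)=\mu_{\min}/4$ and $|\delta|<\delta_0$. Put $$\mathbf{L}_1(\delta)=\sum_{\mu>0}\frac{\mathbf{P}_\mu\mathbf{B}(\delta)\mathbf{P}_0}{\mu}\left(\mathbf{I}-\frac{\delta^2}{\mu}\,\mathbf{P}_0\mathbf{A}^{(2)}\mathbf{P}_0\right)^{-1},$$ where the sum is over all positive eigenvalues $\mu$ of $\mathbf{A}$, and $\mathbf{L}(\delta)=\mathbf{L}_1(\delta)+\mathbf{L}_1(\delta)^{\rm T}$. Then $$\big\|\mathbf{P}_0^\perp(\delta)-\mathbf{P}_0^\perp-\mathbf{L}(\delta)\big\|\le 16\,C\,\frac{\|\mathbf{S}_0\mathbf{B}(\delta)\|\,\|\mathbf{S}_0\mathbf{B}(\delta)\mathbf{P}_0\|}{1-4\|\mathbf{B}(\delta)\|/\mu_{\min}},\qquad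 C=\frac{e^{1/6}}{\sqrt{\pi}}.$$ -/

import Mathlib

open scoped Matrix Matrix.Norms.L2Operator

/-! Matrices carry the spectral norm, i.e. the operator norm between Euclidean spaces. -/

noncomputable section

namespace SignalSubspace

/-- The matrix of the orthogonal projector of `ℝ^L` onto the subspace `U`. -/
def projMatrix {L : ℕ} (U : Submodule ℝ (EuclideanSpace ℝ (Fin L))) :
    Matrix (Fin L) (Fin L) ℝ :=
  (Matrix.toEuclideanCLM (n := Fin L) (𝕜 := ℝ)).symm U.starProjection

/-- The orthogonal projector `P_μ` onto the eigenspace `{x | A x = μ x}` of the square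
matrix `A` (it is zero when `μ` is not an eigenvalue). -/
def eigenProj {L : ℕ} (A : Matrix (Fin L) (Fin L) ℝ) (μ : ℝ) : Matrix (Fin L) (Fin L) ℝ :=
  projMatrix (Module.End.eigenspace (Matrix.toEuclideanLin A) μ)

theorem finite_posEigenvalues {L : ℕ} (A : Matrix (Fin L) (Fin L) ℝ) :
    {μ : ℝ | Module.End.HasEigenvalue (Matrix.toEuclideanLin A) μ ∧ 0 < μ}.Finite :=
  (Module.End.finite_hasEigenvalue (Matrix.toEuclideanLin A)).subset fun _ h => h.1

/-- The finite set of positive eigenvalues of `A`. -/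
def posEigenvalues {L : ℕ} (A : Matrix (Fin L) (Fin L) ℝ) : Finset ℝ :=
  (finite_posEigenvalues A).toFinset

/-- The minimal positive eigenvalue of `A`, for `A` having a positive eigenvalue. -/
def muMin {L : ℕ} (A : Matrix (Fin L) (Fin L) ℝ) : ℝ :=
  sInf (posEigenvalues A : Set ℝ)

/-- The Moore–Penrose pseudoinverse of a symmetric positive semidefinite matrix `A`:
the sum of `P_μ / μ` over the positive eigenvalues `μ` of `A`.
See `isMoorePenrose_pinv` for the four Penrose equations. -/
def pinv {L : ℕ} (A : Matrix (Fin L) (Fin L) ℝ) : Matrix (Fin L) (Fin L) ℝ :=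
  ∑ μ ∈ posEigenvalues A, μ⁻¹ • eigenProj A μ

/-- `A⁽¹⁾ = H Eᵀ + E Hᵀ`. -/
def A₁ {L K : ℕ} (H E : Matrix (Fin L) (Fin K) ℝ) : Matrix (Fin L) (Fin L) ℝ :=
  H * Eᵀ + E * Hᵀ

/-- `A⁽²⁾ = E Eᵀ`. -/
def A₂ {L K : ℕ} (E : Matrix (Fin L) (Fin K) ℝ) : Matrix (Fin L) (Fin L) ℝ :=
  E * Eᵀ

/-- The perturbation **B**`(δ) = δ A⁽¹⁾ + δ² A⁽²⁾` of `H Hᵀ`. -/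
def pert {L K : ℕ} (H E : Matrix (Fin L) (Fin K) ℝ) (δ : ℝ) : Matrix (Fin L) (Fin L) ℝ :=
  δ • A₁ H E + δ ^ 2 • A₂ E

/-- The scalar function `B(δ) = |δ| ‖A⁽¹⁾‖ + δ² ‖A⁽²⁾‖`. -/
def pertBound {L K : ℕ} (H E : Matrix (Fin L) (Fin K) ℝ) (δ : ℝ) : ℝ :=
  |δ| * ‖A₁ H E‖ + δ ^ 2 * ‖A₂ E‖

/-- The projector `P₀` onto the zero eigenspace of `H Hᵀ`. -/
def P₀ {L K : ℕ} (H : Matrix (Fin L) (Fin K) ℝ) : Matrix (Fin L) (Fin L) ℝ :=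
  eigenProj (H * Hᵀ) 0

/-- The pseudoinverse `S₀` of `H Hᵀ`. -/
def S₀ {L K : ℕ} (H : Matrix (Fin L) (Fin K) ℝ) : Matrix (Fin L) (Fin L) ℝ :=
  pinv (H * Hᵀ)

/-- The matrix `L₁(δ) = ∑_{μ > 0} (P_μ B(δ) P₀ / μ) (I - δ² P₀ A⁽²⁾ P₀ / μ)⁻¹`, the sum being over
the positive eigenvalues of `H Hᵀ`. -/
def L₁ {L K : ℕ} (H E : Matrix (Fin L) (Fin K) ℝ) (δ : ℝ) : Matrix (Fin L) (Fin L) ℝ :=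
  ∑ μ ∈ posEigenvalues (H * Hᵀ),
    (μ⁻¹ • (eigenProj (H * Hᵀ) μ * pert H E δ * P₀ H)) *
      (1 - (δ ^ 2 / μ) • (P₀ H * A₂ E * P₀ H))⁻¹

/-- `U` is a linear space spanned by `d` leading left singular vectors of `M`: there is an
orthonormal basis of eigenvectors of `M Mᵀ`, listed in nonincreasing order of the eigenvalues,
such that `U` is spanned by its first `d` members. -/
def IsLeadingLeftSingularSpace {L K : ℕ} (M : Matrix (Fin L) (Fin K) ℝ) (d : ℕ)
    (U : Submodule ℝ (EuclideanSpace ℝ (Fin L))) : Prop :=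
  ∃ (u : OrthonormalBasis (Fin L) ℝ (EuclideanSpace ℝ (Fin L))) (ev : Fin L → ℝ),
    Antitone ev ∧ (∀ i, Matrix.toEuclideanLin (M * Mᵀ) (u i) = ev i • u i) ∧
      U = Submodule.span ℝ (u '' {i : Fin L | (i : ℕ) < d})

theorem isSymmetric_toEuclideanLin {L : ℕ} {A : Matrix (Fin L) (Fin L) ℝ} (hA : A.PosSemidef) :
    (Matrix.toEuclideanLin A).IsSymmetric :=
  (Matrix.isPositive_toEuclideanLin_iff.2 hA).isSymmetric

theorem posSemidef_mul_transpose {L K : ℕ} (M : Matrix (Fin L) (Fin K) ℝ) :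
    (M * Mᵀ).PosSemidef := by
  simpa using Matrix.posSemidef_self_mul_conjTranspose M

/-- Spaces spanned by leading left singular vectors exist. -/
theorem exists_isLeadingLeftSingularSpace {L K : ℕ} (M : Matrix (Fin L) (Fin K) ℝ) (d : ℕ) :
    ∃ U, IsLeadingLeftSingularSpace M d U := by
  have hT := isSymmetric_toEuclideanLin (posSemidef_mul_transpose M)
  have hn : Module.finrank ℝ (EuclideanSpace ℝ (Fin L)) = L := by simp
  exact ⟨_, hT.eigenvectorBasis hn, hT.eigenvalues hn, hT.eigenvalues_antitone hn,
    fun i => hT.apply_eigenvectorBasis hn i, rfl⟩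

/-- `X` satisfies the four Penrose equations for `A`. -/
def IsMoorePenrose {L : ℕ} (A X : Matrix (Fin L) (Fin L) ℝ) : Prop :=
  A * X * A = A ∧ X * A * X = X ∧ (A * X)ᵀ = A * X ∧ (X * A)ᵀ = X * A

theorem transpose_eigenProj {L : ℕ} (A : Matrix (Fin L) (Fin L) ℝ) (μ : ℝ) :
    (eigenProj A μ)ᵀ = eigenProj A μ := by
  have h : star (eigenProj A μ) = eigenProj A μ := by
    rw [eigenProj, projMatrix]
    refine ((Matrix.toEuclideanCLM (n := Fin L) (𝕜 := ℝ)).symm.map_star' _).symm.trans ?_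
    exact congrArg _ (isSelfAdjoint_starProjection _)
  rw [Matrix.star_eq_conjTranspose, Matrix.conjTranspose_eq_transpose_of_trivial] at h
  exact h

theorem toEuclideanLin_eigenProj {L : ℕ} (A : Matrix (Fin L) (Fin L) ℝ) (μ : ℝ)
    (x : EuclideanSpace ℝ (Fin L)) :
    Matrix.toEuclideanLin (eigenProj A μ) x =
      (Module.End.eigenspace (Matrix.toEuclideanLin A) μ).starProjection x := by
  rw [← Matrix.coe_toEuclideanCLM_eq_toEuclideanLin, eigenProj, projMatrix]
  simp

theorem toEuclideanLin_pinv_apply {L : ℕ} {A : Matrix (Fin L) (Fin L) ℝ} (hA : A.PosSemidef)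
    {x : EuclideanSpace ℝ (Fin L)} {c : ℝ} (hx : Matrix.toEuclideanLin A x = c • x) :
    Matrix.toEuclideanLin (pinv A) x = c⁻¹ • x := by
  have hT := isSymmetric_toEuclideanLin hA
  have hproj : ∀ μ : ℝ, Matrix.toEuclideanLin (eigenProj A μ) x = if μ = c then x else 0 := by
    intro μ
    rw [toEuclideanLin_eigenProj]
    have hxc : x ∈ Module.End.eigenspace (Matrix.toEuclideanLin A) c :=
      Module.End.mem_eigenspace_iff.2 hx
    split_ifs with h
    · subst h
      exact Submodule.starProjection_eq_self_iff.2 hxc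
    · refine (Submodule.starProjection_apply_eq_zero_iff _).2 ?_
      rw [Submodule.mem_orthogonal]
      intro y hy
      have h2 := hT y x
      rw [Module.End.mem_eigenspace_iff.1 hy, hx, real_inner_smul_left,
        real_inner_smul_right] at h2
      exact (mul_eq_mul_right_iff.1 h2).resolve_left h
  simp only [pinv, map_sum, map_smul, LinearMap.sum_apply, LinearMap.smul_apply, hproj,
    smul_ite, smul_zero, Finset.sum_ite_eq']
  split_ifs with h
  · rfl
  · by_cases hx0 : x = 0
    · simp [hx0]
    have hev : Module.End.HasEigenvalue (Matrix.toEuclideanLin A) c :=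
      Module.End.hasEigenvalue_of_hasEigenvector
        (Module.End.hasEigenvector_iff.2 ⟨Module.End.mem_eigenspace_iff.2 hx, hx0⟩)
    have hnn : 0 ≤ c := by
      have h1 := (Matrix.isPositive_toEuclideanLin_iff.2 hA).inner_nonneg_right x
      rw [hx, inner_smul_right] at h1
      exact nonneg_of_mul_nonneg_left h1 (real_inner_self_pos.2 hx0)
    have hc : c = 0 := by
      by_contra hne
      exact h ((finite_posEigenvalues A).mem_toFinset.2 ⟨hev, lt_of_le_of_ne hnn (Ne.symm hne)⟩)
    simp [hc]

theorem isMoorePenrose_pinv {L : ℕ} {A : Matrix (Fin L) (Fin L) ℝ} (hA : A.PosSemidef) :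
    IsMoorePenrose A (pinv A) := by
  have hT := isSymmetric_toEuclideanLin hA
  have hn : Module.finrank ℝ (EuclideanSpace ℝ (Fin L)) = L := by simp
  have hb : ∀ i, Matrix.toEuclideanLin A (hT.eigenvectorBasis hn i) =
      hT.eigenvalues hn i • hT.eigenvectorBasis hn i := fun i =>
    hT.apply_eigenvectorBasis hn i
  have hp := fun i => toEuclideanLin_pinv_apply hA (hb i)
  have mulapp : ∀ (X Y : Matrix (Fin L) (Fin L) ℝ) (x : EuclideanSpace ℝ (Fin L)),
      Matrix.toEuclideanLin (X * Y) x = Matrix.toEuclideanLin X (Matrix.toEuclideanLin Y x) := by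
    intro X Y x
    simp [Matrix.toLpLin_apply]
  have ext : ∀ X Y : Matrix (Fin L) (Fin L) ℝ,
      (∀ i, Matrix.toEuclideanLin X (hT.eigenvectorBasis hn i) =
        Matrix.toEuclideanLin Y (hT.eigenvectorBasis hn i)) → X = Y := by
    intro X Y h
    apply Matrix.toEuclideanLin.injective
    exact (hT.eigenvectorBasis hn).toBasis.ext fun i => by simpa using h i
  have hcomm : A * pinv A = pinv A * A := by
    refine ext _ _ fun i => ?_
    rw [mulapp, mulapp, hp, hb, map_smul, map_smul, hb, hp, smul_comm]
  have hSt : (pinv A)ᵀ = pinv A := by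
    simp [pinv, Matrix.transpose_sum, transpose_eigenProj]
  have hAt : Aᵀ = A := by
    simpa [Matrix.IsHermitian] using hA.1
  refine ⟨ext _ _ fun i => ?_, ext _ _ fun i => ?_, ?_, ?_⟩
  · rw [mulapp, mulapp, hb, map_smul, hp, map_smul, map_smul, hb, smul_smul, smul_smul,
      mul_inv_mul_cancel]
  · rw [mulapp, mulapp, hp, map_smul, hb, map_smul, map_smul, hp, smul_smul, smul_smul]
    congr 1
    simpa using mul_inv_mul_cancel (hT.eigenvalues hn i)⁻¹
  · rw [Matrix.transpose_mul, hSt, hAt, hcomm]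
  · rw [Matrix.transpose_mul, hSt, hAt, hcomm]

end SignalSubspace

end

/-! Write `A = H * Hᵀ`, `P` for its kernel projector, `S` for its pseudoinverse, `Q` for the
perturbed projector, `m` for the least positive eigenvalue of `A` and `β = ‖B‖ / m`, which is below
1/4. No contour integral or power series is needed: the remainder is estimated block by block with
respect to `P` and `1 - P`.

Since `Q` commutes with `A + B`, its off-diagonal block `G = (1 - P) * Q * P` satisfies a Sylvester
equation with operator `X ↦ A * X - X * (P * B * P)`. The matrix `L₁` solves the same equation with
only the leading term `(1 - P) * B * P` on the right (`sylvester_solution`, `P₀_pert_P₀`). So `D = G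
- L₁` solves it with a second-order right side, and multiplication by `S` turns this into a
contraction estimate with factor `β`.

The diagonal blocks `P * Q * P` and `(1 - P) * (1 - Q) * (1 - P)` are quadratic in `G` because `Q`
is idempotent (`norm_compression_le`), once min-max eigenvalue bounds show that they are well below
1 (`leading_projector_bounds`).

The remainder has norm at most the larger diagonal block plus `‖D‖` (`norm_projector_remainder_le`).
Scalar inequalities bound this with constant 8 (`remainder_numeric_bound`), and 8 ≤ 16C because C ≥
1/2. -/

namespace SignalSubspace

/-! ### Matrices diagonal in an orthonormal basis, min-max bounds, projectors. -/

section Diagonal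

variable {L : ℕ} (u : OrthonormalBasis (Fin L) ℝ (EuclideanSpace ℝ (Fin L)))

theorem toEuclideanLin_mul_apply (X Y : Matrix (Fin L) (Fin L) ℝ) (x : EuclideanSpace ℝ (Fin L)) :
    Matrix.toEuclideanLin (X * Y) x = Matrix.toEuclideanLin X (Matrix.toEuclideanLin Y x) := by
  simp

theorem toEuclideanLin_one_apply (x : EuclideanSpace ℝ (Fin L)) :
    Matrix.toEuclideanLin (1 : Matrix (Fin L) (Fin L) ℝ) x = x := by
  simp

theorem norm_toEuclideanLin_le (X : Matrix (Fin L) (Fin L) ℝ) (x : EuclideanSpace ℝ (Fin L)) :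
    ‖Matrix.toEuclideanLin X x‖ ≤ ‖X‖ * ‖x‖ := by
  rw [← Matrix.coe_toEuclideanCLM_eq_toEuclideanLin, Matrix.l2_opNorm_def]
  exact ContinuousLinearMap.le_opNorm _ _

theorem norm_le_of_toEuclideanLin {X : Matrix (Fin L) (Fin L) ℝ} {m : ℝ} (hm : 0 ≤ m)
    (h : ∀ x, ‖Matrix.toEuclideanLin X x‖ ≤ m * ‖x‖) : ‖X‖ ≤ m := by
  rw [Matrix.l2_opNorm_def]
  exact ContinuousLinearMap.opNorm_le_bound _ hm h

variable {u}

theorem matrix_ext_basis {X Y : Matrix (Fin L) (Fin L) ℝ}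
    (h : ∀ i, Matrix.toEuclideanLin X (u i) = Matrix.toEuclideanLin Y (u i)) : X = Y := by
  apply Matrix.toEuclideanLin.injective
  exact u.toBasis.ext fun i => by simpa using h i

theorem apply_eq_sum_of_diagonal {X : Matrix (Fin L) (Fin L) ℝ} {c : Fin L → ℝ}
    (hX : ∀ i, Matrix.toEuclideanLin X (u i) = c i • u i) (x : EuclideanSpace ℝ (Fin L)) :
    Matrix.toEuclideanLin X x = ∑ i, (c i * inner ℝ (u i) x) • u i := by
  conv_lhs => rw [← u.sum_repr' x]
  simp [map_sum, hX, smul_smul, mul_comm]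

theorem inner_basis_apply_of_diagonal {X : Matrix (Fin L) (Fin L) ℝ} {c : Fin L → ℝ}
    (hX : ∀ i, Matrix.toEuclideanLin X (u i) = c i • u i) (x : EuclideanSpace ℝ (Fin L))
    (i : Fin L) :
    inner ℝ (u i) (Matrix.toEuclideanLin X x) = c i * inner ℝ (u i) x := by
  rw [apply_eq_sum_of_diagonal hX, inner_sum, Finset.sum_eq_single i]
  · simp [inner_smul_right]
  · intro j _ hj
    simp [inner_smul_right, u.inner_eq_ite, hj.symm]
  · simp

theorem norm_sq_eq_sum (x : EuclideanSpace ℝ (Fin L)) :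
    ‖x‖ ^ 2 = ∑ i, (inner ℝ (u i) x) ^ 2 := by
  rw [← u.sum_sq_norm_inner_right x]
  simp

theorem norm_sq_apply_of_diagonal {X : Matrix (Fin L) (Fin L) ℝ} {c : Fin L → ℝ}
    (hX : ∀ i, Matrix.toEuclideanLin X (u i) = c i • u i) (x : EuclideanSpace ℝ (Fin L)) :
    ‖Matrix.toEuclideanLin X x‖ ^ 2 = ∑ i, c i ^ 2 * (inner ℝ (u i) x) ^ 2 := by
  rw [norm_sq_eq_sum (u := u)]
  simp only [inner_basis_apply_of_diagonal hX, mul_pow]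

theorem inner_apply_of_diagonal {X : Matrix (Fin L) (Fin L) ℝ} {c : Fin L → ℝ}
    (hX : ∀ i, Matrix.toEuclideanLin X (u i) = c i • u i) (x : EuclideanSpace ℝ (Fin L)) :
    inner ℝ x (Matrix.toEuclideanLin X x) = ∑ i, c i * (inner ℝ (u i) x) ^ 2 := by
  rw [apply_eq_sum_of_diagonal hX, inner_sum]
  refine Finset.sum_congr rfl fun i _ => ?_
  rw [inner_smul_right, real_inner_comm]
  ring

theorem norm_le_of_diagonal {X : Matrix (Fin L) (Fin L) ℝ} {c : Fin L → ℝ} {m : ℝ} (hm : 0 ≤ m)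
    (hX : ∀ i, Matrix.toEuclideanLin X (u i) = c i • u i) (hc : ∀ i, |c i| ≤ m) : ‖X‖ ≤ m := by
  refine norm_le_of_toEuclideanLin hm fun x => ?_
  refine abs_le_of_sq_le_sq' ?_ (by positivity) |>.2
  rw [norm_sq_apply_of_diagonal hX, mul_pow, norm_sq_eq_sum (u := u), Finset.mul_sum]
  refine Finset.sum_le_sum fun i _ => ?_
  exact mul_le_mul_of_nonneg_right (sq_le_sq' (abs_le.1 (hc i)).1 (abs_le.1 (hc i)).2) (sq_nonneg _)

theorem commute_of_diagonal {X Y : Matrix (Fin L) (Fin L) ℝ} {c e : Fin L → ℝ}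
    (hX : ∀ i, Matrix.toEuclideanLin X (u i) = c i • u i)
    (hY : ∀ i, Matrix.toEuclideanLin Y (u i) = e i • u i) : X * Y = Y * X := by
  refine matrix_ext_basis (u := u) fun i => ?_
  simp only [toEuclideanLin_mul_apply, hX, hY, map_smul]
  rw [smul_comm]

/-- A subspace of dimension larger than `#s` contains a non-zero vector orthogonal to the
basis vectors indexed by `s`. -/
theorem exists_mem_orthogonal_basis (u : OrthonormalBasis (Fin L) ℝ (EuclideanSpace ℝ (Fin L)))
    (W : Submodule ℝ (EuclideanSpace ℝ (Fin L))) (s : Finset (Fin L))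
    (h : s.card < Module.finrank ℝ W) :
    ∃ x ∈ W, x ≠ 0 ∧ ∀ j ∈ s, inner ℝ (u j) x = 0 := by
  let f : W →ₗ[ℝ] (s → ℝ) :=
    LinearMap.pi fun j => (innerSL ℝ (u j)).toLinearMap ∘ₗ W.subtype
  have hf : LinearMap.ker f ≠ ⊥ := LinearMap.ker_ne_bot_of_finrank_lt (by simpa using h)
  obtain ⟨x, hx, hx0⟩ := Submodule.exists_mem_ne_zero_of_ne_bot hf
  refine ⟨x, x.2, by simpa using hx0, fun j hj => ?_⟩
  exact congrFun (LinearMap.mem_ker.1 hx) ⟨j, hj⟩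

/-- A lower bound for leading eigenvalues by the quadratic form on a subspace. -/
theorem le_eigenvalue_of_subspace {M : Matrix (Fin L) (Fin L) ℝ} {ev : Fin L → ℝ}
    (hev : Antitone ev) (hM : ∀ i, Matrix.toEuclideanLin M (u i) = ev i • u i)
    (W : Submodule ℝ (EuclideanSpace ℝ (Fin L))) {m : ℝ}
    (hW : ∀ x ∈ W, m * ‖x‖ ^ 2 ≤ inner ℝ x (Matrix.toEuclideanLin M x)) (i : Fin L)
    (hi : (i : ℕ) < Module.finrank ℝ W) : m ≤ ev i := by
  -- `Finset.Iio i` has exactly `i` elements, fewer than the dimension of `W`; on such an `x` only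
  -- eigenvalues at most `ev i` contribute.
  obtain ⟨x, hxW, hx0, hx⟩ := exists_mem_orthogonal_basis u W (Finset.Iio i) (by simpa using hi)
  refine le_of_mul_le_mul_right ((hW x hxW).trans ?_) (pow_pos (norm_pos_iff.2 hx0) 2)
  rw [inner_apply_of_diagonal hM, norm_sq_eq_sum (u := u), Finset.mul_sum]
  refine Finset.sum_le_sum fun j _ => ?_
  rcases lt_or_ge j i with hj | hj
  · simp [hx j (by simpa using hj)]
  · exact mul_le_mul_of_nonneg_right (hev hj) (sq_nonneg _)

/-- An upper bound for trailing eigenvalues by the quadratic form on a subspace. -/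
theorem eigenvalue_le_of_subspace {M : Matrix (Fin L) (Fin L) ℝ} {ev : Fin L → ℝ}
    (hev : Antitone ev) (hM : ∀ i, Matrix.toEuclideanLin M (u i) = ev i • u i)
    (W : Submodule ℝ (EuclideanSpace ℝ (Fin L))) {m : ℝ}
    (hW : ∀ x ∈ W, inner ℝ x (Matrix.toEuclideanLin M x) ≤ m * ‖x‖ ^ 2) (i : Fin L)
    (hi : L < Module.finrank ℝ W + (i + 1)) : ev i ≤ m := by
  -- `Finset.Ioi i` has `L - 1 - i` elements, whence the `i + 1` in the dimension condition.
  obtain ⟨x, hxW, hx0, hx⟩ := exists_mem_orthogonal_basis u W (Finset.Ioi i) (by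
    rw [Fin.card_Ioi]; omega)
  refine le_of_mul_le_mul_right (le_trans ?_ (hW x hxW)) (pow_pos (norm_pos_iff.2 hx0) 2)
  rw [inner_apply_of_diagonal hM, norm_sq_eq_sum (u := u), Finset.mul_sum]
  refine Finset.sum_le_sum fun j _ => ?_
  rcases lt_or_ge i j with hj | hj
  · simp [hx j (by simpa using hj)]
  · exact mul_le_mul_of_nonneg_right (hev hj) (sq_nonneg _)

theorem toEuclideanLin_projMatrix (U : Submodule ℝ (EuclideanSpace ℝ (Fin L)))
    (x : EuclideanSpace ℝ (Fin L)) :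
    Matrix.toEuclideanLin (projMatrix U) x = U.starProjection x := by
  rw [← Matrix.coe_toEuclideanCLM_eq_toEuclideanLin, projMatrix]
  simp

theorem projMatrix_span_basis (u : OrthonormalBasis (Fin L) ℝ (EuclideanSpace ℝ (Fin L)))
    (s : Set (Fin L)) [DecidablePred (· ∈ s)] (i : Fin L) :
    Matrix.toEuclideanLin (projMatrix (Submodule.span ℝ (u '' s))) (u i) =
      (if i ∈ s then (1 : ℝ) else 0) • u i := by
  rw [toEuclideanLin_projMatrix]
  split_ifs with h
  · rw [one_smul]
    exact Submodule.starProjection_eq_self_iff.2 (Submodule.subset_span ⟨i, h, rfl⟩)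
  · rw [zero_smul]
    refine (Submodule.starProjection_apply_eq_zero_iff _).2 ?_
    rw [Submodule.mem_orthogonal]
    intro y hy
    induction hy using Submodule.span_induction with
    | mem y hy =>
      obtain ⟨j, hj, rfl⟩ := hy
      rw [u.inner_eq_ite, if_neg]
      rintro rfl
      exact h hj
    | zero => simp
    | add y z _ _ hy hz => rw [inner_add_left, hy, hz, add_zero]
    | smul c y _ hy => rw [inner_smul_left, hy, mul_zero]

theorem transpose_projMatrix (U : Submodule ℝ (EuclideanSpace ℝ (Fin L))) :
    (projMatrix U)ᵀ = projMatrix U := by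
  have h : star (projMatrix U) = projMatrix U := by
    rw [projMatrix]
    refine ((Matrix.toEuclideanCLM (n := Fin L) (𝕜 := ℝ)).symm.map_star' _).symm.trans ?_
    exact congrArg _ (isSelfAdjoint_starProjection _)
  rw [Matrix.star_eq_conjTranspose, Matrix.conjTranspose_eq_transpose_of_trivial] at h
  exact h

theorem projMatrix_mul_self (U : Submodule ℝ (EuclideanSpace ℝ (Fin L))) :
    projMatrix U * projMatrix U = projMatrix U := by
  apply Matrix.toEuclideanLin.injective
  ext1 x
  rw [toEuclideanLin_mul_apply, toEuclideanLin_projMatrix, toEuclideanLin_projMatrix]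
  exact Submodule.starProjection_eq_self_iff.2 (Submodule.starProjection_apply_mem _ _)

end Diagonal

/-! ### Spectral norm and orthogonal blocks. -/

section Blocks

variable {L : ℕ}

theorem inner_toEuclideanLin_left (X : Matrix (Fin L) (Fin L) ℝ)
    (x y : EuclideanSpace ℝ (Fin L)) :
    inner ℝ (Matrix.toEuclideanLin X x) y = inner ℝ x (Matrix.toEuclideanLin Xᵀ y) := by
  have := Matrix.toEuclideanLin_conjTranspose_eq_adjoint X
  rw [Matrix.conjTranspose_eq_transpose_of_trivial] at this
  rw [this, LinearMap.adjoint_inner_right]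

/-- Pythagoras for the sum of two matrices with orthogonal ranges. -/
theorem norm_add_apply_sq {X Y : Matrix (Fin L) (Fin L) ℝ} (h : Xᵀ * Y = 0)
    (x y : EuclideanSpace ℝ (Fin L)) :
    ‖Matrix.toEuclideanLin X x + Matrix.toEuclideanLin Y y‖ ^ 2 =
      ‖Matrix.toEuclideanLin X x‖ ^ 2 + ‖Matrix.toEuclideanLin Y y‖ ^ 2 := by
  rw [norm_add_sq_real, inner_toEuclideanLin_left, ← toEuclideanLin_mul_apply, h]
  simp

/-- The spectral norm of a sum of two matrices with orthogonal ranges and orthogonal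
coimages, the latter being separated by the projector `P`. -/
theorem norm_add_le_max_of_orthogonal {P X Y : Matrix (Fin L) (Fin L) ℝ} (hPt : Pᵀ = P)
    (hPP : P * P = P) (hXY : Xᵀ * Y = 0) (hX : X * P = X) (hY : Y * P = 0) :
    ‖X + Y‖ ≤ max ‖X‖ ‖Y‖ := by
  have hm : 0 ≤ max ‖X‖ ‖Y‖ := (norm_nonneg X).trans (le_max_left _ _)
  refine norm_le_of_toEuclideanLin hm fun v => ?_
  refine abs_le_of_sq_le_sq' ?_ (by positivity) |>.2
  -- `X` sees only the component `P v` and `Y` only `(1 - P) v`, so Pythagoras applies to both input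
  -- and output.
  have e1 : Matrix.toEuclideanLin (X + Y) v =
      Matrix.toEuclideanLin X (Matrix.toEuclideanLin P v) +
        Matrix.toEuclideanLin Y (Matrix.toEuclideanLin (1 - P) v) := by
    rw [← toEuclideanLin_mul_apply, ← toEuclideanLin_mul_apply, hX, mul_sub, hY]
    simp
  have e2 : ‖v‖ ^ 2 = ‖Matrix.toEuclideanLin P v‖ ^ 2 +
      ‖Matrix.toEuclideanLin (1 - P) v‖ ^ 2 := by
    rw [← norm_add_apply_sq (by rw [hPt, mul_sub, hPP]; simp)]
    simp
  rw [e1, norm_add_apply_sq hXY, mul_pow, e2, mul_add, ← mul_pow, ← mul_pow]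
  gcongr
  · exact (norm_toEuclideanLin_le _ _).trans (by gcongr; exact le_max_left _ _)
  · exact (norm_toEuclideanLin_le _ _).trans (by gcongr; exact le_max_right _ _)

end Blocks

/-! ### Spectral calculus of a positive semidefinite matrix. -/

section Spectral

variable {L : ℕ} {A : Matrix (Fin L) (Fin L) ℝ}

theorem exists_eigenbasis (hA : A.PosSemidef) :
    ∃ (u : OrthonormalBasis (Fin L) ℝ (EuclideanSpace ℝ (Fin L))) (c : Fin L → ℝ),
      (∀ i, Matrix.toEuclideanLin A (u i) = c i • u i) ∧
      (∀ i, c i = 0 ∨ c i ∈ posEigenvalues A) := by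
  have hT := isSymmetric_toEuclideanLin hA
  have hn : Module.finrank ℝ (EuclideanSpace ℝ (Fin L)) = L := by simp
  have hb := hT.apply_eigenvectorBasis hn
  refine ⟨hT.eigenvectorBasis hn, hT.eigenvalues hn, hb, fun i => ?_⟩
  have hnn : 0 ≤ hT.eigenvalues hn i := by
    have h1 := (Matrix.isPositive_toEuclideanLin_iff.2 hA).inner_nonneg_right
      (hT.eigenvectorBasis hn i)
    rw [hb, inner_smul_right] at h1
    simpa using h1
  rcases hnn.eq_or_lt with h | h
  · exact Or.inl h.symm
  · exact Or.inr ((finite_posEigenvalues A).mem_toFinset.2 ⟨hT.hasEigenvalue_eigenvalues hn i, h⟩)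

theorem eigenProj_apply_of_eigenvector (hA : A.PosSemidef) {x : EuclideanSpace ℝ (Fin L)} {c : ℝ}
    (hx : Matrix.toEuclideanLin A x = c • x) (μ : ℝ) :
    Matrix.toEuclideanLin (eigenProj A μ) x = (if μ = c then (1 : ℝ) else 0) • x := by
  rw [toEuclideanLin_eigenProj]
  have hxc : x ∈ Module.End.eigenspace (Matrix.toEuclideanLin A) c :=
    Module.End.mem_eigenspace_iff.2 hx
  split_ifs with h
  · subst h
    rw [one_smul]
    exact Submodule.starProjection_eq_self_iff.2 hxc
  · rw [zero_smul]
    refine (Submodule.starProjection_apply_eq_zero_iff _).2 ?_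
    rw [Submodule.mem_orthogonal]
    intro y hy
    have h2 := isSymmetric_toEuclideanLin hA y x
    rw [Module.End.mem_eigenspace_iff.1 hy, hx, real_inner_smul_left,
      real_inner_smul_right] at h2
    exact (mul_eq_mul_right_iff.1 h2).resolve_left h

theorem pos_of_mem_posEigenvalues {μ : ℝ} (h : μ ∈ posEigenvalues A) : 0 < μ :=
  ((finite_posEigenvalues A).mem_toFinset.1 h).2

theorem muMin_le {μ : ℝ} (h : μ ∈ posEigenvalues A) : muMin A ≤ μ :=
  csInf_le (posEigenvalues A).bddBelow (by simpa using h)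

theorem muMin_pos (hA : A.PosSemidef) (hA0 : A ≠ 0) : 0 < muMin A := by
  have hne : (posEigenvalues A).Nonempty := by
    rw [Finset.nonempty_iff_ne_empty]
    intro he
    obtain ⟨u, c, hu, hc⟩ := exists_eigenbasis hA
    refine hA0 (matrix_ext_basis (u := u) fun i => ?_)
    have : c i = 0 := by simpa [he] using hc i
    simp [hu, this]
  refine pos_of_mem_posEigenvalues (A := A) ?_
  simpa [muMin] using hne.csInf_mem

theorem mul_eigenProj (μ : ℝ) : A * eigenProj A μ = μ • eigenProj A μ := by
  apply Matrix.toEuclideanLin.injective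
  ext1 x
  rw [toEuclideanLin_mul_apply, map_smul, LinearMap.smul_apply, toEuclideanLin_eigenProj]
  exact Module.End.mem_eigenspace_iff.1 (Submodule.starProjection_apply_mem _ _)

theorem sum_eigenProj (hA : A.PosSemidef) :
    ∑ μ ∈ posEigenvalues A, eigenProj A μ = 1 - eigenProj A 0 := by
  obtain ⟨u, c, hu, hc⟩ := exists_eigenbasis hA
  refine matrix_ext_basis (u := u) fun i => ?_
  simp only [map_sum, map_sub, LinearMap.sum_apply, LinearMap.sub_apply, toEuclideanLin_one_apply,
    eigenProj_apply_of_eigenvector hA (hu i), ite_smul, one_smul, zero_smul,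
    Finset.sum_ite_eq']
  rcases hc i with h | h
  · have : (0 : ℝ) ∉ posEigenvalues A := fun h0 => (pos_of_mem_posEigenvalues h0).false
    simp [h, this]
  · simp [h, (pos_of_mem_posEigenvalues h).ne]

theorem pinv_mul_self_eq (hA : A.PosSemidef) : pinv A * A = 1 - eigenProj A 0 := by
  obtain ⟨u, c, hu, hc⟩ := exists_eigenbasis hA
  refine matrix_ext_basis (u := u) fun i => ?_
  rw [toEuclideanLin_mul_apply, hu, map_smul, toEuclideanLin_pinv_apply hA (hu i), map_sub,
    LinearMap.sub_apply, toEuclideanLin_one_apply, eigenProj_apply_of_eigenvector hA (hu i)]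
  rcases eq_or_ne (c i) 0 with h | h
  · simp [h]
  · simp [h, h.symm]

theorem pinv_mul_eigenProj_zero (hA : A.PosSemidef) : pinv A * eigenProj A 0 = 0 := by
  obtain ⟨u, c, hu, hc⟩ := exists_eigenbasis hA
  refine matrix_ext_basis (u := u) fun i => ?_
  rw [toEuclideanLin_mul_apply, eigenProj_apply_of_eigenvector hA (hu i), map_smul,
    toEuclideanLin_pinv_apply hA (hu i)]
  rcases eq_or_ne (c i) 0 with h | h
  · simp [h]
  · simp [h.symm]

theorem norm_pinv_le (hA : A.PosSemidef) (hA0 : A ≠ 0) : ‖pinv A‖ ≤ (muMin A)⁻¹ := by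
  obtain ⟨u, c, hu, hc⟩ := exists_eigenbasis hA
  have hμ := muMin_pos hA hA0
  refine norm_le_of_diagonal (u := u) (inv_nonneg.2 hμ.le)
    (fun i => toEuclideanLin_pinv_apply hA (hu i)) fun i => ?_
  rcases hc i with h | h
  · simpa [h] using hμ.le
  · have := pos_of_mem_posEigenvalues h
    rw [abs_of_pos (by positivity)]
    exact inv_anti₀ hμ (muMin_le h)

/-- Spectral gap: in an eigenbasis, the coordinates of `x` along the kernel vanish and all others
carry eigenvalues at least `muMin A`. -/
theorem muMin_mul_norm_sq_le (hA : A.PosSemidef) {x : EuclideanSpace ℝ (Fin L)}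
    (hx : x ∈ (Module.End.eigenspace (Matrix.toEuclideanLin A) 0)ᗮ) :
    muMin A * ‖x‖ ^ 2 ≤ inner ℝ x (Matrix.toEuclideanLin A x) := by
  obtain ⟨u, c, hu, hc⟩ := exists_eigenbasis hA
  rw [inner_apply_of_diagonal hu, norm_sq_eq_sum (u := u), Finset.mul_sum]
  refine Finset.sum_le_sum fun i _ => ?_
  rcases hc i with h | h
  · have : inner ℝ (u i) x = 0 :=
      Submodule.inner_right_of_mem_orthogonal (Module.End.mem_eigenspace_iff.2 (by rw [hu, h])) hx
    simp [this]
  · exact mul_le_mul_of_nonneg_right (muMin_le h) (sq_nonneg _)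

theorem finrank_eigenspace_zero_add_rank (A : Matrix (Fin L) (Fin L) ℝ) :
    A.rank + Module.finrank ℝ (Module.End.eigenspace (Matrix.toEuclideanLin A) 0) = L := by
  have h := LinearMap.finrank_range_add_finrank_ker (Matrix.toEuclideanLin A)
  rw [Module.End.eigenspace_zero]
  rw [finrank_euclideanSpace_fin] at h
  rwa [Matrix.rank_eq_finrank_range_toLin A (EuclideanSpace.basisFun _ ℝ).toBasis
    (EuclideanSpace.basisFun _ ℝ).toBasis, ← Matrix.toEuclideanLin_eq_toLin_orthonormal]

end Spectral

/-! ### The scalar inequalities. -/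

/-- In the application `a`, `c` are the norms of `S * B`, `S * B * P`; `g` is that of the
off-diagonal block of the projector, `s` and `t` those of the diagonal blocks of its error, and `d`
that of the off-diagonal error. The a priori bounds select the small root of `s ≤ g ^ 2 + s ^ 2`,
making `s`, `t` of order `g ^ 2`; then `hG` gives `g ≤ k * c`, and everything is of order `a * c`.
-/
theorem remainder_numeric_bound {β a c g s t d : ℝ} (hβ : β < 1 / 4)
    (hc : 0 ≤ c) (hca : c ≤ a) (haβ : a ≤ β) (hg : 0 ≤ g) (hs : 0 ≤ s) (ht : 0 ≤ t)
    (hsβ : (1 - β) ^ 2 * s ≤ β ^ 2) (htβ : t ≤ 4 * β ^ 2) (hgβ : (1 - β) * g ≤ β)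
    (hsg : s ≤ g ^ 2 + s ^ 2) (htg : t ≤ g ^ 2 + t ^ 2)
    (hG : (1 - β) * g ≤ c + (β * t + a * g + c * s))
    (hD : (1 - β) * d ≤ β * t + a * g + c * s) :
    max s t + d ≤ 8 * (a * c / (1 - 4 * β)) := by
  have ha : 0 ≤ a := hc.trans hca
  have hβ0 : 0 ≤ β := ha.trans haβ
  have hac : 0 ≤ a * c := mul_nonneg ha hc
  have hcc : c ^ 2 ≤ a * c := by nlinarith
  -- Here `b` and `r` bound `β` and `g`, while `p` and `q` keep `s` and `t` away from 1. The last
  -- condition on `k` is what absorbing the `g` terms of `hG` requires for `g ≤ k * c`.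
  have key : ∀ b p q r k : ℝ, 0 ≤ b → b < 1 → 0 < p → 0 < q → 0 < k → β ≤ b →
      s ≤ 1 - p → t ≤ 1 - q → g ≤ r → 
      (2 - p) ≤ k * (1 - 2 * b - b * r / q) →
      max s t ≤ k ^ 2 / (min p q) * (a * c) ∧ 
      (1 - b) * d ≤ (b * k ^ 2 / q + k + b * k ^ 2 / p) * (a * c) := by
    intro b p q r k hb hb1 hp hq hk hβb hsp htq hgr hkk
    have h1 : p * s ≤ g ^ 2 := by nlinarith
    have h2 : q * t ≤ g ^ 2 := by nlinarith
    have h2' : t ≤ g ^ 2 / q := by rw [le_div_iff₀ hq]; linarith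
    have h1' : s ≤ g ^ 2 / p := by rw [le_div_iff₀ hp]; linarith
    have h3 : g * (1 - 2 * b - b * r / q) ≤ c * (2 - p) := by
      have e1 : β * t ≤ b * (g * r / q) := by
        refine mul_le_mul hβb (h2'.trans ?_) ht hb
        gcongr; nlinarith
      have e2 : a * g ≤ b * g := by gcongr; linarith
      have e3 : c * s ≤ c * (1 - p) := by gcongr
      have e4 : (1 - b) * g ≤ (1 - β) * g := by gcongr
      have e5 : b * (g * r / q) = g * (b * r / q) := by ring
      nlinarith
    have hp1 : 0 < 2 - p := by linarith
    have h4 : g ≤ k * c := by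
      have : (2 - p) * g ≤ (2 - p) * (k * c) := by
        calc (2 - p) * g ≤ k * (1 - 2 * b - b * r / q) * g := by gcongr
          _ = k * (g * (1 - 2 * b - b * r / q)) := by ring
          _ ≤ k * (c * (2 - p)) := by gcongr
          _ = _ := by ring
      exact le_of_mul_le_mul_left this hp1
    have h5 : g ^ 2 ≤ k ^ 2 * (a * c) := by
      calc g ^ 2 ≤ (k * c) ^ 2 := by gcongr
        _ = k ^ 2 * c ^ 2 := by ring
        _ ≤ _ := by gcongr
    have hmin : 0 < min p q := lt_min hp hq
    have h6 : t ≤ k ^ 2 * (a * c) / q := h2'.trans (by gcongr)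
    have h7 : s ≤ k ^ 2 * (a * c) / p := h1'.trans (by gcongr)
    constructor
    · rw [div_mul_eq_mul_div]
      refine max_le (h7.trans ?_) (h6.trans ?_)
      · gcongr; exact min_le_left _ _
      · gcongr; exact min_le_right _ _
    -- The sign of `d` is not assumed, and replacing `1 - β` by `1 - b` needs `d` nonnegative.
    · rcases le_or_gt d 0 with hd | hd
      · exact (mul_nonpos_of_nonneg_of_nonpos (by linarith) hd).trans (by positivity)
      have e1 : β * t ≤ b * (k ^ 2 * (a * c) / q) := mul_le_mul hβb h6 ht hb
      have e2 : a * g ≤ a * (k * c) := by gcongr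
      have e3 : c * s ≤ b * (k ^ 2 * (a * c) / p) := mul_le_mul (by linarith) h7 hs hb
      have e4 : (1 - b) * d ≤ (1 - β) * d := by gcongr
      have e5 : (b * k ^ 2 / q + k + b * k ^ 2 / p) * (a * c) = b * (k ^ 2 * (a * c) / q) +
        a * (k * c) + b * (k ^ 2 * (a * c) / p) := by ring
      linarith
  have hpos : 0 < 1 - 4 * β := by linarith
  rcases le_or_gt β (1 / 6) with h | h
  · have hb2 : β ^ 2 ≤ (1 / 6) ^ 2 := pow_le_pow_left₀ hβ0 h 2
    have h1 : s ≤ 1 - 24 / 25 := by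
      have h0 : (5 / 6 : ℝ) ^ 2 ≤ (1 - β) ^ 2 := pow_le_pow_left₀ (by norm_num) (by linarith) 2
      have := mul_le_mul_of_nonneg_right h0 hs
      linarith
    have h3 : g ≤ 1 / 5 := by
      have : (5 / 6 : ℝ) * g ≤ (1 - β) * g := by gcongr; linarith
      linarith
    -- At `β = 1/6`: `s ≤ 1/25`, `t ≤ 1/9`, `g ≤ 1/5`; 1.66 is just above the least admissible `k`.
    obtain ⟨k1, k2⟩ := key (1 / 6) (24 / 25) (8 / 9) (1 / 5) (1.66) (by norm_num) (by norm_num)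
      (by norm_num) (by norm_num) (by norm_num) h h1 (by linarith) h3 (by norm_num)
    rw [min_eq_right (by norm_num)] at k1
    have h8 : a * c ≤ a * c / (1 - 4 * β) := by
      rw [le_div_iff₀ hpos]
      linarith [mul_nonneg hac hβ0]
    norm_num at k1 k2
    rw [max_def] at *
    split_ifs at * <;> linarith
  · have hb2 : β ^ 2 ≤ (1 / 4) ^ 2 := pow_le_pow_left₀ hβ0 hβ.le 2
    have h1 : s ≤ 1 - 8 / 9 := by
      have h0 : (3 / 4 : ℝ) ^ 2 ≤ (1 - β) ^ 2 := pow_le_pow_left₀ (by norm_num) (by linarith) 2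
      have := mul_le_mul_of_nonneg_right h0 hs
      linarith
    have h3 : g ≤ 1 / 3 := by
      have : (3 / 4 : ℝ) * g ≤ (1 - β) * g := by gcongr; linarith
      linarith
    -- At `β = 1/4`: `s ≤ 1/9`, `t ≤ 1/4`, `g ≤ 1/3`, and `k` must be at least 20/7. The total
    -- coefficient now exceeds 8 but not 24, which suffices as `1 - 4 * β < 1/3`.
    obtain ⟨k1, k2⟩ := key (1 / 4) (8 / 9) (3 / 4) (1 / 3) (2.86) (by norm_num) (by norm_num)
      (by norm_num) (by norm_num) (by norm_num) hβ.le h1 (by linarith) h3 (by norm_num)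
    rw [min_eq_right (by norm_num)] at k1
    have h8 : 3 * (a * c) ≤ a * c / (1 - 4 * β) := by
      rw [le_div_iff₀ hpos]
      linarith [mul_nonneg hac (sub_nonneg.2 h.le)]
    norm_num at k1 k2
    rw [max_def] at *
    split_ifs at * <;> linarith

/-! ### Block estimate of the projector remainder. -/

section Remainder

variable {L : ℕ}

theorem norm_transpose_eq (X : Matrix (Fin L) (Fin L) ℝ) : ‖Xᵀ‖ = ‖X‖ := by
  rw [← Matrix.conjTranspose_eq_transpose_of_trivial, Matrix.l2_opNorm_conjTranspose]

theorem norm_transpose_mul_self (X : Matrix (Fin L) (Fin L) ℝ) : ‖Xᵀ * X‖ = ‖X‖ ^ 2 := by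
  rw [← Matrix.conjTranspose_eq_transpose_of_trivial, Matrix.l2_opNorm_conjTranspose_mul_self, sq]

theorem norm_le_one_of_projector {P : Matrix (Fin L) (Fin L) ℝ} (hPt : Pᵀ = P)
    (hPP : P * P = P) : ‖P‖ ≤ 1 := by
  have h := norm_transpose_mul_self P
  rw [hPt, hPP] at h
  nlinarith [norm_nonneg P]

theorem norm_mul_projector_le {P : Matrix (Fin L) (Fin L) ℝ} (hPt : Pᵀ = P) (hPP : P * P = P)
    (X : Matrix (Fin L) (Fin L) ℝ) : ‖X * P‖ ≤ ‖X‖ :=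
  (norm_mul_le _ _).trans
    (mul_le_of_le_one_right (norm_nonneg _) (norm_le_one_of_projector hPt hPP))

theorem norm_projector_mul_le {P : Matrix (Fin L) (Fin L) ℝ} (hPt : Pᵀ = P) (hPP : P * P = P)
    (X : Matrix (Fin L) (Fin L) ℝ) : ‖P * X‖ ≤ ‖X‖ :=
  (norm_mul_le _ _).trans
    (mul_le_of_le_one_left (norm_nonneg _) (norm_le_one_of_projector hPt hPP))

theorem one_sub_mul_self_of_projector {P : Matrix (Fin L) (Fin L) ℝ} (hPP : P * P = P) :
    (1 - P) * (1 - P) = 1 - P := by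
  simp [mul_sub, sub_mul, hPP]

/-- Insert `1 = (1 - P) + P` between the two factors of `Q = Q * Q`. It serves both for `P, Q` and
for the complementary pair `1 - P, 1 - Q`. -/
theorem norm_compression_le {P Q : Matrix (Fin L) (Fin L) ℝ} (hPt : Pᵀ = P) (hPP : P * P = P)
    (hQt : Qᵀ = Q) (hQQ : Q * Q = Q) :
    ‖P * Q * P‖ ≤ ‖(1 - P) * Q * P‖ ^ 2 + ‖P * Q * P‖ ^ 2 := by
  have hPPx : ∀ X, P * (P * X) = P * X := fun X => by rw [← mul_assoc, hPP]
  have hQQx : ∀ X, Q * (Q * X) = Q * X := fun X => by rw [← mul_assoc, hQQ]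
  have e : P * Q * P = ((1 - P) * Q * P)ᵀ * ((1 - P) * Q * P) + (P * Q * P) * (P * Q * P) := by
    simp only [Matrix.transpose_mul, Matrix.transpose_sub, Matrix.transpose_one, hPt, hQt]
    simp only [mul_sub, sub_mul, mul_assoc, one_mul, hPPx, hQQx]
    abel
  calc ‖P * Q * P‖ = ‖((1 - P) * Q * P)ᵀ * ((1 - P) * Q * P) + (P * Q * P) * (P * Q * P)‖ :=
        congrArg _ e
    _ ≤ ‖((1 - P) * Q * P)ᵀ * ((1 - P) * Q * P)‖ + ‖P * Q * P‖ * ‖P * Q * P‖ :=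
      (norm_add_le _ _).trans (by gcongr; exact norm_mul_le _ _)
    _ = _ := by rw [norm_transpose_mul_self, sq ‖P * Q * P‖]

set_option maxHeartbeats 1000000 in
/-- If `Q` is a spectral projector of `A + B` close to the projector `1 - P` onto the range of
`A`, and `Y` solves the Sylvester equation `A Y - Y (P B P) = (1 - P) B P`, then `Q` is
approximated by `1 - P + Y + Yᵀ` up to second order terms. -/
theorem norm_projector_remainder_le {A B S P Q Y : Matrix (Fin L) (Fin L) ℝ} {m : ℝ}
    (hm : 0 < m) (hAt : Aᵀ = A) (hPt : Pᵀ = P) (hPP : P * P = P) (hQt : Qᵀ = Q)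
    (hQQ : Q * Q = Q) (hAP : A * P = 0) (hSA : S * A = 1 - P) (hSP : S * P = 0)
    (hS : ‖S‖ ≤ m⁻¹) (hBm : ‖B‖ / m < 1 / 4) (hcomm : Q * (A + B) = (A + B) * Q)
    (hlow : (m - ‖B‖) * ‖Q * P‖ ≤ ‖B‖) (hupp : ‖(A + B) * (1 - Q)‖ ≤ ‖B‖)
    (hY : A * Y - Y * (P * B * P) = (1 - P) * B * P) (hPY : P * Y = 0) :
    ‖Q - (1 - P) - (Y + Yᵀ)‖ ≤
      8 * (‖S * B‖ * ‖S * B * P‖ / (1 - 4 * (‖B‖ / m))) := by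
  have hPA : P * A = 0 := by
    rw [← Matrix.transpose_inj, Matrix.transpose_mul, hPt, hAt, hAP, Matrix.transpose_zero]
  have hRt : (1 - P)ᵀ = 1 - P := by rw [Matrix.transpose_sub, hPt, Matrix.transpose_one]
  have hRR := one_sub_mul_self_of_projector hPP
  have hPR : P * (1 - P) = 0 := by rw [mul_sub, hPP, mul_one, sub_self]
  have hQ't : (1 - Q)ᵀ = 1 - Q := by rw [Matrix.transpose_sub, hQt, Matrix.transpose_one]
  have hQ'Q' := one_sub_mul_self_of_projector hQQ
  have hPPx : ∀ X, P * (P * X) = P * X := fun X => by rw [← mul_assoc, hPP]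
  have hQQx : ∀ X, Q * (Q * X) = Q * X := fun X => by rw [← mul_assoc, hQQ]
  have hSAx : ∀ X, S * (A * X) = X - P * X := fun X => by rw [← mul_assoc, hSA, sub_mul, one_mul]
  have hSPx : ∀ X, S * (P * X) = 0 := fun X => by rw [← mul_assoc, hSP, zero_mul]
  have hPAx : ∀ X, P * (A * X) = 0 := fun X => by rw [← mul_assoc, hPA, zero_mul]
  have hAQP : A * (Q * P) = Q * (B * P) - B * (Q * P) := by
    have := congrArg (· * P) hcomm
    simp only [mul_add, add_mul, mul_assoc, hAP, mul_zero, zero_add] at this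
    rw [this]; abel
  have hPBQP : P * (B * (Q * P)) = P * (Q * (B * P)) := by
    have := congrArg (P * ·) hAQP
    simp only [hPAx, mul_sub] at this
    exact (sub_eq_zero.1 this.symm).symm
  set β := ‖B‖ / m with hβdef
  have hβ0 : 0 ≤ β := by positivity
  have hβm : m⁻¹ * ‖B‖ = β := by rw [hβdef]; field_simp
  set G := (1 - P) * Q * P with hGdef
  set T := (1 - P) * (1 - Q) * (1 - P) with hTdef
  set D := G - Y with hDdef
  set V := S * T * B * P + S * B * G + S * B * P * (P * Q * P) with hVdef
  -- Subtract the equation for `Y` from that for `G`. Each term left on the right contains `B` and a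
  -- block of the projector error.
  have hDeq : A * D - D * (P * B * P) =
      -(T * B * P) - (1 - P) * B * G - (1 - P) * B * P * (P * Q * P) := by
    have e : A * D - D * (P * B * P) =
        A * G - G * (P * B * P) - (A * Y - Y * (P * B * P)) := by
      rw [hDdef]; noncomm_ring
    rw [e, hY, hGdef, hTdef]
    simp only [mul_sub, sub_mul, mul_assoc, one_mul, mul_one, hPP, hPPx, hAP, hAQP, hPBQP,
      ← mul_assoc A P, zero_mul]
    abel
  have hPD : P * D = 0 := by
    rw [hDdef, hGdef, mul_sub, hPY]
    simp only [mul_sub, sub_mul, mul_assoc, one_mul, hPPx, sub_self]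
  -- `S` inverts `A` on matrices killed by `P` from the left, so the Sylvester equation becomes a
  -- fixed-point equation.
  have hDV : D = S * (D * (P * B * P)) - V := by
    have e : S * (A * D) = D := by rw [hSAx, hPD, sub_zero]
    have e2 : A * D = D * (P * B * P) +
        (-(T * B * P) - (1 - P) * B * G - (1 - P) * B * P * (P * Q * P)) := by
      rw [← hDeq]; abel
    rw [e2] at e
    conv_lhs => rw [← e]
    rw [hVdef]
    simp only [mul_sub, mul_add, mul_neg, sub_mul, one_mul, mul_assoc, hSPx]
    abel
  have hYV : Y = S * (Y * (P * B * P)) + S * B * P := by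
    have e : S * (A * Y) = Y := by rw [hSAx, hPY, sub_zero]
    have e2 : A * Y = Y * (P * B * P) + (1 - P) * B * P := by rw [← hY]; abel
    rw [e2] at e
    conv_lhs => rw [← e]
    simp only [mul_sub, mul_add, sub_mul, one_mul, mul_assoc, hSPx]
    abel
  have hGV : G = S * (G * (P * B * P)) + (S * B * P - V) := by
    have e : G = Y + D := by rw [hDdef]; abel
    rw [e, add_mul, mul_add]
    nth_rewrite 1 [hYV]
    nth_rewrite 1 [hDV]
    abel
  have hPBP : ‖P * B * P‖ ≤ ‖B‖ :=
    (norm_mul_projector_le hPt hPP _).trans (norm_projector_mul_le hPt hPP _)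
  have hSyl : ∀ X, ‖S * (X * (P * B * P))‖ ≤ β * ‖X‖ := fun X => by
    calc ‖S * (X * (P * B * P))‖ ≤ ‖S‖ * (‖X‖ * ‖P * B * P‖) :=
          (norm_mul_le _ _).trans (by gcongr; exact norm_mul_le _ _)
      _ ≤ m⁻¹ * (‖X‖ * ‖B‖) := by gcongr
      _ = β * ‖X‖ := by rw [← hβm]; ring
  have hV : ‖V‖ ≤ β * ‖T‖ + ‖S * B‖ * ‖G‖ + ‖S * B * P‖ * ‖P * Q * P‖ := by
    refine (norm_add₃_le).trans ?_
    gcongr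
    · calc ‖S * T * B * P‖ ≤ ‖S * T * B‖ := norm_mul_projector_le hPt hPP _
        _ ≤ ‖S‖ * ‖T‖ * ‖B‖ := (norm_mul_le _ _).trans (by gcongr; exact norm_mul_le _ _)
        _ ≤ m⁻¹ * ‖T‖ * ‖B‖ := by gcongr
        _ = β * ‖T‖ := by rw [← hβm]; ring
    · exact norm_mul_le _ _
    · exact norm_mul_le _ _
  have hD : (1 - β) * ‖D‖ ≤ β * ‖T‖ + ‖S * B‖ * ‖G‖ + ‖S * B * P‖ * ‖P * Q * P‖ := by
    have h1 : ‖D‖ ≤ β * ‖D‖ + ‖V‖ := by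
      nth_rewrite 1 [hDV]
      exact (norm_sub_le _ _).trans (by gcongr; exact hSyl D)
    linarith
  have hG : (1 - β) * ‖G‖ ≤ ‖S * B * P‖ +
      (β * ‖T‖ + ‖S * B‖ * ‖G‖ + ‖S * B * P‖ * ‖P * Q * P‖) := by
    have h1 : ‖G‖ ≤ β * ‖G‖ + (‖S * B * P‖ + ‖V‖) := by
      nth_rewrite 1 [hGV]
      exact (norm_add_le _ _).trans (add_le_add (hSyl G) (norm_sub_le _ _))
    linarith
  have hs : ‖P * Q * P‖ = ‖Q * P‖ ^ 2 := by
    rw [← norm_transpose_mul_self, Matrix.transpose_mul, hQt, hPt, mul_assoc, mul_assoc, hQQx]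
  have ht : ‖T‖ = ‖(1 - Q) * (1 - P)‖ ^ 2 := by
    rw [← norm_transpose_mul_self, Matrix.transpose_mul, hQ't, hRt, mul_assoc,
      ← mul_assoc (1 - Q) (1 - Q), hQ'Q', ← mul_assoc]
  have hlow' : (1 - β) * ‖Q * P‖ ≤ β := by
    have : (1 - β) * ‖Q * P‖ = m⁻¹ * ((m - ‖B‖) * ‖Q * P‖) := by
      rw [← hβm]; field_simp
    rw [this, ← hβm]
    gcongr
  have hQP0 : 0 ≤ (1 - β) * ‖Q * P‖ := mul_nonneg (by linarith) (norm_nonneg _)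
  have hsβ : (1 - β) ^ 2 * ‖P * Q * P‖ ≤ β ^ 2 := by
    rw [hs, ← mul_pow]
    exact pow_le_pow_left₀ hQP0 hlow' 2
  have hgβ : (1 - β) * ‖G‖ ≤ β := by
    refine le_trans (mul_le_mul_of_nonneg_left ?_ (by linarith)) hlow'
    rw [hGdef, mul_assoc]
    exact norm_projector_mul_le hRt hRR _
  have htβ : ‖T‖ ≤ 4 * β ^ 2 := by
    -- Write `1 - P` as `S * A` and `A` as `(A + B) - B`; each of the two terms then contributes at
    -- most `β`.
    have h1 : ((1 - Q) * (1 - P))ᵀ = S * ((A + B) * (1 - Q) - B * (1 - Q)) := by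
      rw [Matrix.transpose_mul, hQ't, hRt, ← hSA]
      noncomm_ring
    have h2 : ‖(1 - Q) * (1 - P)‖ ≤ 2 * β := by
      rw [← norm_transpose_eq, h1]
      calc _ ≤ ‖S‖ * (‖B‖ + ‖B‖) := by
            refine (norm_mul_le _ _).trans ?_
            gcongr
            exact (norm_sub_le _ _).trans
              (add_le_add hupp (norm_mul_projector_le hQ't hQ'Q' _))
        _ ≤ m⁻¹ * (‖B‖ + ‖B‖) := by gcongr
        _ = 2 * β := by rw [← hβm]; ring
    rw [ht]
    calc _ ≤ (2 * β) ^ 2 := by gcongr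
      _ = _ := by ring
  have hsg : ‖P * Q * P‖ ≤ ‖G‖ ^ 2 + ‖P * Q * P‖ ^ 2 := norm_compression_le hPt hPP hQt hQQ
  have htg : ‖T‖ ≤ ‖G‖ ^ 2 + ‖T‖ ^ 2 := by
    have h := norm_compression_le hRt hRR hQ't hQ'Q'
    have e : (1 - (1 - P)) * (1 - Q) * (1 - P) = -Gᵀ := by
      rw [hGdef]
      simp only [Matrix.transpose_mul, hPt, hQt, hRt]
      simp only [mul_sub, sub_mul, mul_assoc, one_mul, mul_one, hPP]
      abel
    rwa [e, norm_neg, norm_transpose_eq] at h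
  have haβ : ‖S * B‖ ≤ β := by
    rw [← hβm]
    exact (norm_mul_le _ _).trans (by gcongr)
  have hDP : D * P = D := by
    -- The other two terms of the Sylvester equation end in `P`, so `A * Y * (1 - P) = 0`, and `S`
    -- recovers `Y * (1 - P)`.
    have hYP : Y * (1 - P) = 0 := by
      have e : S * (A * (Y * (1 - P))) = Y * (1 - P) := by
        rw [hSAx, ← mul_assoc P, hPY, zero_mul, sub_zero]
      have e2 : A * (Y * (1 - P)) = (Y * (P * B * P) + (1 - P) * B * P) * (1 - P) := by
        rw [← hY]; noncomm_ring
      rw [← e, e2]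
      simp only [add_mul, mul_assoc, hPR, mul_zero, add_zero]
    have hYP' : Y * P = Y := by
      rw [mul_sub, mul_one, sub_eq_zero] at hYP
      exact hYP.symm
    rw [hDdef, sub_mul, hYP', hGdef, mul_assoc, hPP]
  -- Diagonal and off-diagonal parts; the lower diagonal block is `-T` because `1 - P` is
  -- subtracted.
  have hsplit : Q - (1 - P) - (Y + Yᵀ) = (P * Q * P + -T) + (D + Dᵀ) := by
    rw [hDdef, hGdef, hTdef, Matrix.transpose_sub]
    simp only [Matrix.transpose_mul, hPt, hQt, hRt]
    simp only [mul_sub, sub_mul, mul_assoc, one_mul, mul_one, hPP]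
    abel
  have hPT : P * T = 0 := by
    rw [hTdef, ← mul_assoc, ← mul_assoc, hPR, zero_mul, zero_mul]
  have hTP : T * P = 0 := by
    rw [hTdef, mul_assoc, sub_mul 1 P P, hPP, one_mul, sub_self, mul_zero]
  have hdiag : ‖P * Q * P + -T‖ ≤ max ‖P * Q * P‖ ‖T‖ := by
    rw [← norm_neg T]
    refine norm_add_le_max_of_orthogonal hPt hPP ?_ (by rw [mul_assoc, hPP]) ?_
    · simp [Matrix.transpose_mul, hPt, hQt, mul_assoc, hPT]
    · rw [neg_mul, hTP, neg_zero]
  have hoff : ‖D + Dᵀ‖ ≤ ‖D‖ := by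
    refine (norm_add_le_max_of_orthogonal hPt hPP ?_ hDP ?_).trans ?_
    · rw [← Matrix.transpose_mul, ← hDP, mul_assoc, hDP, hPD, mul_zero, Matrix.transpose_zero]
    · rw [← hPt, ← Matrix.transpose_mul, hPD, Matrix.transpose_zero]
    · rw [norm_transpose_eq, max_self]
  rw [hsplit]
  refine ((norm_add_le _ _).trans (add_le_add hdiag hoff)).trans ?_
  exact remainder_numeric_bound hBm (norm_nonneg _) (norm_mul_projector_le hPt hPP _) haβ
    (norm_nonneg _) (norm_nonneg _) (norm_nonneg _) hsβ htβ hgβ hsg htg hG hD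

end Remainder

/-! ### Perturbed spectral projector and the Sylvester equation. -/

section SignalMatrices

variable {L : ℕ}

theorem abs_inner_toEuclideanLin_le (B : Matrix (Fin L) (Fin L) ℝ)
    (x : EuclideanSpace ℝ (Fin L)) :
    |inner ℝ x (Matrix.toEuclideanLin B x)| ≤ ‖B‖ * ‖x‖ ^ 2 := by
  calc _ ≤ ‖x‖ * ‖Matrix.toEuclideanLin B x‖ := abs_real_inner_le_norm _ _
    _ ≤ ‖x‖ * (‖B‖ * ‖x‖) := by gcongr; exact norm_toEuclideanLin_le _ _
    _ = _ := by ring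

/-- Properties of the projector onto a leading invariant subspace of the positive
semidefinite matrix `A + B`, whose dimension is the rank of `A`. -/
theorem leading_projector_bounds {A B : Matrix (Fin L) (Fin L) ℝ} (hA : A.PosSemidef)
    (hAB : (A + B).PosSemidef) (hB : ‖B‖ < muMin A)
    (u : OrthonormalBasis (Fin L) ℝ (EuclideanSpace ℝ (Fin L))) {ev : Fin L → ℝ}
    (hev : Antitone ev) (hu : ∀ i, Matrix.toEuclideanLin (A + B) (u i) = ev i • u i)
    {Q : Matrix (Fin L) (Fin L) ℝ}
    (hQ : Q = projMatrix (Submodule.span ℝ (u '' {i : Fin L | (i : ℕ) < A.rank}))) :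
    Q * (A + B) = (A + B) * Q ∧
      (muMin A - ‖B‖) * ‖Q * eigenProj A 0‖ ≤ ‖B‖ ∧ ‖(A + B) * (1 - Q)‖ ≤ ‖B‖ := by
  classical
  set N := Module.End.eigenspace (Matrix.toEuclideanLin A) 0 with hN
  have hQu : ∀ i, Matrix.toEuclideanLin Q (u i) =
      (if i ∈ {i : Fin L | (i : ℕ) < A.rank} then (1 : ℝ) else 0) • u i := fun i => by
    rw [hQ]; exact projMatrix_span_basis u _ i
  have hcomm : Q * (A + B) = (A + B) * Q := commute_of_diagonal hQu hu
  have hQt : Qᵀ = Q := by rw [hQ]; exact transpose_projMatrix _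
  have hQQ : Q * Q = Q := by rw [hQ]; exact projMatrix_mul_self _
  have hPt : (eigenProj A 0)ᵀ = eigenProj A 0 := transpose_eigenProj A 0
  have hPP : eigenProj A 0 * eigenProj A 0 = eigenProj A 0 := projMatrix_mul_self _
  have hdim : A.rank + Module.finrank ℝ N = L := finrank_eigenspace_zero_add_rank A
  have hdim' : Module.finrank ℝ Nᗮ = A.rank := by
    have := N.finrank_add_finrank_orthogonal
    rw [finrank_euclideanSpace_fin] at this
    exact Nat.add_left_cancel (this.trans (by rw [add_comm]; exact hdim.symm))
  have hform : ∀ x, inner ℝ x (Matrix.toEuclideanLin (A + B) x) =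
      inner ℝ x (Matrix.toEuclideanLin A x) + inner ℝ x (Matrix.toEuclideanLin B x) := fun x => by
    rw [map_add, LinearMap.add_apply, inner_add_right]
  -- Test on the orthogonal complement of the kernel, of dimension `A.rank`; `htrail` tests on the
  -- kernel itself.
  have hlead : ∀ i : Fin L, (i : ℕ) < A.rank → muMin A - ‖B‖ ≤ ev i := fun i hi => by
    refine le_eigenvalue_of_subspace hev hu Nᗮ (fun x hx => ?_) i (by rwa [hdim'])
    have h1 := muMin_mul_norm_sq_le hA hx
    have h2 := (abs_le.1 (abs_inner_toEuclideanLin_le B x)).1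
    rw [hform]
    linarith
  have htrail : ∀ i : Fin L, ¬ (i : ℕ) < A.rank → ev i ≤ ‖B‖ := fun i hi => by
    refine eigenvalue_le_of_subspace hev hu N (fun x hx => ?_) i (by omega)
    have h1 : Matrix.toEuclideanLin A x = 0 := by
      simpa using Module.End.mem_eigenspace_iff.1 hx
    rw [hform, h1, inner_zero_right, zero_add]
    exact (abs_le.1 (abs_inner_toEuclideanLin_le B x)).2
  have hnn : ∀ i, 0 ≤ ev i := fun i => by
    have h1 := (Matrix.isPositive_toEuclideanLin_iff.2 hAB).inner_nonneg_right (u i)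
    rw [hu, inner_smul_right] at h1
    simpa using h1
  refine ⟨hcomm, ?_, ?_⟩
  · have hm : 0 < muMin A - ‖B‖ := sub_pos.2 hB
    have hMQ : ∀ i, Matrix.toEuclideanLin ((A + B) * Q) (u i) =
        ((if i ∈ {i : Fin L | (i : ℕ) < A.rank} then (1 : ℝ) else 0) * ev i) • u i := fun i => by
      rw [toEuclideanLin_mul_apply, hQu, map_smul, hu, smul_smul]
    have hbelow : ∀ x, (muMin A - ‖B‖) * ‖Matrix.toEuclideanLin Q x‖ ≤
        ‖Matrix.toEuclideanLin ((A + B) * Q) x‖ := fun x => by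
      refine abs_le_of_sq_le_sq' ?_ (norm_nonneg _) |>.2
      rw [mul_pow, norm_sq_apply_of_diagonal hMQ, norm_sq_apply_of_diagonal hQu, Finset.mul_sum]
      refine Finset.sum_le_sum fun i _ => ?_
      split_ifs with hi
      · rw [one_pow, one_mul, one_mul]
        gcongr
        exact hlead i hi
      · simp
    rw [mul_comm, ← le_div_iff₀ hm]
    refine norm_le_of_toEuclideanLin (by positivity) fun x => ?_
    rw [div_mul_eq_mul_div, le_div_iff₀ hm, mul_comm, toEuclideanLin_mul_apply]
    refine (hbelow _).trans ?_
    -- Commutation moves `A` next to its kernel projector, leaving only `B`; `hbelow` then bounds `Q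
    -- * P`.
    have e : (A + B) * Q * eigenProj A 0 = Q * (B * eigenProj A 0) := by
      rw [← hcomm, mul_assoc, add_mul, mul_eigenProj, zero_smul, zero_add]
    rw [← toEuclideanLin_mul_apply, e]
    refine (norm_toEuclideanLin_le _ _).trans ?_
    gcongr
    exact (norm_projector_mul_le hQt hQQ _).trans (norm_mul_projector_le hPt hPP _)
  · refine norm_le_of_diagonal (u := u) (c := fun i =>
      (if i ∈ {i : Fin L | (i : ℕ) < A.rank} then (0 : ℝ) else ev i)) (norm_nonneg _)
      (fun i => ?_) fun i => ?_
    · rw [toEuclideanLin_mul_apply, map_sub, LinearMap.sub_apply, toEuclideanLin_one_apply, hQu]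
      split_ifs
      · simp
      · simp only [zero_smul, sub_zero, hu]
    · split_ifs with hi
      · simp
      · rw [abs_of_nonneg (hnn i)]
        exact htrail i hi

theorem isUnit_one_sub_of_norm_lt_one {X : Matrix (Fin L) (Fin L) ℝ} (h : ‖X‖ < 1) :
    IsUnit (1 - X) := by
  have : CompleteSpace (Matrix (Fin L) (Fin L) ℝ) := FiniteDimensional.complete ℝ _
  exact (Units.oneSub X h).isUnit

/-- The sum of resolvent terms solves the Sylvester equation `A Y - Y C = (1 - P) B P`
for `C` of norm below the minimal positive eigenvalue of `A`. -/
theorem sylvester_solution {A B C : Matrix (Fin L) (Fin L) ℝ} (hA : A.PosSemidef)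
    (hA0 : A ≠ 0) (hC : ‖C‖ < muMin A) {Y : Matrix (Fin L) (Fin L) ℝ}
    (hY : Y = ∑ μ ∈ posEigenvalues A,
      (μ⁻¹ • (eigenProj A μ * B * eigenProj A 0)) * (1 - μ⁻¹ • C)⁻¹) :
    A * Y - Y * C = (1 - eigenProj A 0) * B * eigenProj A 0 ∧ eigenProj A 0 * Y = 0 := by
  have hμ0 := muMin_pos hA hA0
  constructor
  -- The equation decouples: `A` acts as `μ` on the range of `eigenProj A μ`, so each summand only
  -- has to invert `μ - C`.
  · rw [hY, Finset.mul_sum, Finset.sum_mul, ← Finset.sum_sub_distrib, ← sum_eigenProj hA,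
      Finset.sum_mul, Finset.sum_mul]
    refine Finset.sum_congr rfl fun μ hμ => ?_
    have hpos := pos_of_mem_posEigenvalues hμ
    have hunit : IsUnit (1 - μ⁻¹ • C).det := by
      rw [← Matrix.isUnit_iff_isUnit_det]
      refine isUnit_one_sub_of_norm_lt_one ?_
      rw [norm_smul, Real.norm_of_nonneg (inv_nonneg.2 hpos.le), inv_mul_lt_iff₀ hpos, mul_one]
      exact hC.trans_le (muMin_le hμ)
    set Z := eigenProj A μ * B * eigenProj A 0 with hZ
    have hAZ : A * Z = μ • Z := by
      rw [hZ, ← mul_assoc, ← mul_assoc, mul_eigenProj, smul_mul_assoc, smul_mul_assoc]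
    have e1 : A * ((μ⁻¹ • Z) * (1 - μ⁻¹ • C)⁻¹) = Z * (1 - μ⁻¹ • C)⁻¹ := by
      rw [← mul_assoc, mul_smul_comm, hAZ, smul_smul, inv_mul_cancel₀ hpos.ne', one_smul]
    have e2 : (μ⁻¹ • Z) * (1 - μ⁻¹ • C)⁻¹ * C = Z * (1 - μ⁻¹ • C)⁻¹ * (μ⁻¹ • C) := by
      rw [smul_mul_assoc, smul_mul_assoc, mul_smul_comm]
    have e3 := Matrix.nonsing_inv_mul _ hunit
    rw [e1, e2, mul_assoc Z, ← mul_sub]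
    conv_rhs => rw [← mul_one Z, ← e3]
    rw [mul_sub (1 - μ⁻¹ • C)⁻¹, mul_one]
  · rw [hY, Finset.mul_sum]
    refine Finset.sum_eq_zero fun μ hμ => ?_
    have hpos := pos_of_mem_posEigenvalues hμ
    have hz : eigenProj A 0 * eigenProj A μ = 0 := by
      obtain ⟨u, c, hu, -⟩ := exists_eigenbasis hA
      refine matrix_ext_basis (u := u) fun i => ?_
      rw [toEuclideanLin_mul_apply, eigenProj_apply_of_eigenvector hA (hu i), map_smul,
        eigenProj_apply_of_eigenvector hA (hu i)]
      rcases eq_or_ne (c i) 0 with h | h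
      · simp [h, hpos.ne']
      · simp [h.symm]
    rw [← mul_assoc, mul_smul_comm, ← mul_assoc, ← mul_assoc, hz]
    simp

/-! ### The matrices built from `H` and `E`. -/

variable {K : ℕ}

theorem add_pert_eq (H E : Matrix (Fin L) (Fin K) ℝ) (δ : ℝ) :
    (H + δ • E) * (H + δ • E)ᵀ = H * Hᵀ + pert H E δ := by
  simp only [pert, A₁, A₂, Matrix.transpose_add, Matrix.transpose_smul, Matrix.add_mul,
    Matrix.mul_add, Matrix.smul_mul, Matrix.mul_smul, smul_add, smul_smul, sq]
  abel

theorem norm_pert_le (H E : Matrix (Fin L) (Fin K) ℝ) (δ : ℝ) :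
    ‖pert H E δ‖ ≤ pertBound H E δ := by
  refine (norm_add_le _ _).trans (le_of_eq ?_)
  rw [norm_smul, norm_smul, Real.norm_eq_abs, Real.norm_of_nonneg (sq_nonneg δ), pertBound]

theorem pertBound_lt {H E : Matrix (Fin L) (Fin K) ℝ} (hE : E ≠ 0) {δ δ₀ : ℝ} (hδ : |δ| < δ₀) :
    pertBound H E δ < pertBound H E δ₀ := by
  -- Strictness must come from the quadratic term, since `A₁ H E` may vanish.
  have h0 : 0 < ‖A₂ E‖ := by
    rw [norm_pos_iff, A₂]
    intro h
    refine hE (Matrix.self_mul_conjTranspose_eq_zero.1 ?_)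
    rwa [Matrix.conjTranspose_eq_transpose_of_trivial]
  have h1 : δ ^ 2 < δ₀ ^ 2 := sq_lt_sq' (abs_lt.1 hδ).1 (abs_lt.1 hδ).2
  exact add_lt_add_of_le_of_lt
    (mul_le_mul_of_nonneg_right (hδ.le.trans (le_abs_self _)) (norm_nonneg _))
    (mul_lt_mul_of_pos_right h1 h0)

theorem P₀_mul (H : Matrix (Fin L) (Fin K) ℝ) : P₀ H * H = 0 := by
  have h : H * Hᵀ * P₀ H = 0 := by rw [P₀, mul_eigenProj, zero_smul]
  refine Matrix.self_mul_conjTranspose_eq_zero.1 ?_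
  rw [Matrix.conjTranspose_eq_transpose_of_trivial, Matrix.transpose_mul, P₀, transpose_eigenProj,
    Matrix.mul_assoc, ← Matrix.mul_assoc H, ← P₀, h, Matrix.mul_zero]

/-- Since `P₀ H * H = 0`, compression kills the part linear in `δ`. This identifies the inverse in
`L₁` with the resolvent of `P₀ B P₀`. -/
theorem P₀_pert_P₀ (H E : Matrix (Fin L) (Fin K) ℝ) (δ : ℝ) :
    P₀ H * pert H E δ * P₀ H = δ ^ 2 • (P₀ H * A₂ E * P₀ H) := by
  have h2 : Hᵀ * P₀ H = 0 := by
    have h := congrArg Matrix.transpose (P₀_mul H)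
    rwa [Matrix.transpose_mul, P₀, transpose_eigenProj, Matrix.transpose_zero] at h
  have h3 : P₀ H * A₁ H E * P₀ H = 0 := by
    rw [A₁, Matrix.mul_add, Matrix.add_mul, ← Matrix.mul_assoc, P₀_mul, Matrix.zero_mul,
      Matrix.zero_mul, zero_add, Matrix.mul_assoc, Matrix.mul_assoc E, h2, Matrix.mul_zero,
      Matrix.mul_zero]
  rw [pert, mul_add, add_mul, mul_smul_comm, smul_mul_assoc, h3, mul_smul_comm, smul_mul_assoc,
    smul_zero, zero_add]

theorem half_le_exp_div_sqrt_pi : (1 / 2 : ℝ) ≤ Real.exp (1 / 6) / √Real.pi := by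
  have h1 : √Real.pi ≤ 2 := by
    rw [Real.sqrt_le_left (by norm_num)]
    linarith [Real.pi_le_four]
  have h2 : (1 : ℝ) ≤ Real.exp (1 / 6) := Real.one_le_exp (by norm_num)
  have h3 : 0 < √Real.pi := Real.sqrt_pos.2 Real.pi_pos
  rw [le_div_iff₀ h3]
  linarith

end SignalMatrices

end SignalSubspace

/-! ### Assembly. -/

theorem theorem5 {L K : ℕ} (H E : Matrix (Fin L) (Fin K) ℝ) (hH : H ≠ 0) (hE : E ≠ 0)
    (hrank : H.rank < min L K) (δ₀ δ : ℝ) (hδ₀ : 0 < δ₀)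
    (hB : SignalSubspace.pertBound H E δ₀ = SignalSubspace.muMin (H * Hᵀ) / 4)
    (hδ : |δ| < δ₀)
    (U : Submodule ℝ (EuclideanSpace ℝ (Fin L)))
    (hU : SignalSubspace.IsLeadingLeftSingularSpace (H + δ • E) H.rank U) :
    ‖SignalSubspace.projMatrix U - (1 - SignalSubspace.P₀ H) -
        (SignalSubspace.L₁ H E δ + (SignalSubspace.L₁ H E δ)ᵀ)‖ ≤
      16 * (Real.exp (1 / 6) / √Real.pi) *
        (‖SignalSubspace.S₀ H * SignalSubspace.pert H E δ‖ *
          ‖SignalSubspace.S₀ H * SignalSubspace.pert H E δ * SignalSubspace.P₀ H‖ /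
          (1 - 4 * ‖SignalSubspace.pert H E δ‖ / SignalSubspace.muMin (H * Hᵀ))) := by
  open SignalSubspace in
  obtain ⟨u, ev, hev, hu, rfl⟩ := hU
  set B := pert H E δ with hBdef
  have hA : (H * Hᵀ).PosSemidef := posSemidef_mul_transpose H
  have hAB : (H * Hᵀ + B).PosSemidef := by
    rw [hBdef, ← add_pert_eq]
    exact posSemidef_mul_transpose _
  have hA0 : H * Hᵀ ≠ 0 := by
    rw [← Matrix.conjTranspose_eq_transpose_of_trivial]
    exact fun h => hH (Matrix.self_mul_conjTranspose_eq_zero.1 h)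
  have hμ := muMin_pos hA hA0
  have hBμ : ‖B‖ < muMin (H * Hᵀ) / 4 :=
    (norm_pert_le H E δ).trans_lt ((pertBound_lt hE hδ).trans_eq hB)
  have hβ : ‖B‖ / muMin (H * Hᵀ) < 1 / 4 := by
    rw [div_lt_iff₀ hμ]
    linarith
  rw [add_pert_eq] at hu
  -- The number of leading vectors must be read as the rank of `H * Hᵀ`, the codimension of its
  -- kernel.
  rw [← Matrix.rank_self_mul_transpose H]
  have hPt : (P₀ H)ᵀ = P₀ H := transpose_eigenProj _ _
  have hPP : P₀ H * P₀ H = P₀ H := projMatrix_mul_self _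
  obtain ⟨hcomm, hlow, hupp⟩ := leading_projector_bounds hA hAB (by linarith) u hev hu rfl
  obtain ⟨hY, hPY⟩ := sylvester_solution (B := B) (C := P₀ H * B * P₀ H) (Y := L₁ H E δ) hA hA0
    (((norm_mul_projector_le hPt hPP _).trans (norm_projector_mul_le hPt hPP _)).trans_lt
      (by linarith)) (by
        simp only [L₁, hBdef, P₀_pert_P₀, smul_smul, div_eq_inv_mul]
        rfl)
  have hmain := norm_projector_remainder_le hμ (by
      rw [Matrix.transpose_mul, Matrix.transpose_transpose]) hPt hPP
    (transpose_projMatrix _) (projMatrix_mul_self _)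
    (by rw [P₀, mul_eigenProj, zero_smul]) (pinv_mul_self_eq hA) (pinv_mul_eigenProj_zero hA)
    (norm_pinv_le hA hA0) hβ hcomm hlow hupp hY hPY
  rw [mul_div_assoc 4]
  refine hmain.trans (mul_le_mul_of_nonneg_right (by linarith [half_le_exp_div_sqrt_pi]) ?_)
  exact div_nonneg (by positivity) (by linarith)
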